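/- Let $n\ge 1$, let $0<\xi_1<\dots<\xi_{n-1}<\xi_n=1$ and $g_1,\dots,g_n>0$, and let $g=\sum_{i=1}^n g_i\delta_{\xi_i}$ (a discrete cubic string whose last mass is placed at the end point $1$). For $z\in\mathbb C$ let $\phi(\cdot\,;z)$ be the unique continuous function with $$-\phi_{\xi\xi\xi}=z\,g\,\phi \ \text{ in the sense of distributions},\qquad \phi(0;z)=\phi_\xi(0;z)=0,\quad \phi_{\xi\xi}(0;z)=1,$$ where the string is continued without mass beyond $[0,1]$; the values $\phi(1;z)$, $\phi_\xi(1;z)$, $\phi_{\xi\xi}(1;z)$ are understood as right-hand limits at $\xi=1$ (which exist). The spectrum of type 2 is the set of $z\in\mathbb C$ for which the boundary value problem $-\phi_{\xi\xi\xi}=zg\phi$, $\phi(0)=\phi_\xi(0)=0$, $\phi_{\xi\xi}(1)=0$ has a nonzero solution. It consists of $n$ distinct positive numbers $0<z_{2,1}<\dots<z_{2,n}$. Define the Weyl functions $W(z)=-\dfrac{\phi_\xi(1;z)}{\phi_{\xi\xi}(1;z)}$ and $Z(z)=-\dfrac{\phi(1;z)}{\phi_{\xi\xi}(1;z)}$.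 Then the numbers $$b_i=-\frac{\phi_\xi(1;z_{2,i})}{\phi_{\xi\xi z}(1;z_{2,i})},\qquad i=1,\dots,n,$$ are well defined (the derivatives $\phi_{\xi\xi z}(1;z_{2,i})=\partial_z\phi_{\xi\xi}(1;z)|_{z=z_{2,i}}$ exist and are nonzero), real and positive, and with $\beta=\sum_{i=1}^n b_i\,\delta_{z_{2,i}}$ one has, for every $z\in\mathbb C\setminus\{z_{2,1},\dots,z_{2,n}\}$, $\phi_{\xi\xi}(1;z)\neq 0$ and $$W(z)=\int\frac{1}{z-y}\,d\beta(y),\qquad Z(z)=\iint\frac{1}{(z-y)(x+y)}\,d\beta(x)\,d\beta(y).$$ -/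

import Mathlib

open MeasureTheory Filter Topology
open scoped ContDiff

namespace CubicString

/-- The discrete measure `∑ i, w i • δ_{p i}` on the line (used with positive weights). -/
noncomputable def pointMasses {n : ℕ} (w p : Fin n → ℝ) : Measure ℝ :=
  ∑ i, ENNReal.ofReal (w i) • Measure.dirac (p i)

/-- `φ` is a continuous solution of `-φ''' = z g φ` in the sense of distributions:
`∫ φ η''' dx = z ∫ φ η dg` for every test function `η`. The equation is posed on the whole line,
with no mass outside the support of `g`, so that right-hand limits at the end point `1` of the
string make sense and see a mass placed at `1`. -/
structure IsSolution (g : Measure ℝ) (z : ℂ) (φ : ℝ → ℂ) : Prop where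
  continuous : Continuous φ
  weak_eq : ∀ η : ℝ → ℝ, ContDiff ℝ ∞ η → HasCompactSupport η →
    ∫ x, iteratedDeriv 3 η x • φ x = z * ∫ x, η x • φ x ∂g

/-- The initial value problem `-φ''' = z g φ`, `φ(0) = φ'(0) = 0`, `φ''(0) = 1`. -/
structure IsIVPSolution (g : Measure ℝ) (z : ℂ) (φ : ℝ → ℂ) : Prop extends
    IsSolution g z φ where
  val_zero : φ 0 = 0
  deriv_zero : HasDerivAt φ 0 0
  deriv2_zero : HasDerivAt (deriv φ) 1 0

/-- `z` is an eigenvalue of the boundary value problem of type 2: there is a nonzero solution with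
`φ(0) = φ'(0) = 0` and `φ''(1) = 0`, the last value being the right-hand limit at `1`. -/
def IsEigenvalueType2 (g : Measure ℝ) (z : ℂ) : Prop :=
  ∃ φ : ℝ → ℂ, IsSolution g z φ ∧ φ ≠ 0 ∧ φ 0 = 0 ∧ HasDerivAt φ 0 0 ∧
    Tendsto (iteratedDeriv 2 φ) (𝓝[>] 1) (𝓝 0)

/-- The spectrum of the boundary value problem of type 2. -/
def spectrumType2 (g : Measure ℝ) : Set ℂ := {z | IsEigenvalueType2 g z}

/-- The right-hand limit at `1` of the `k`-th derivative of `φ`. -/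
noncomputable def endValue (k : ℕ) (φ : ℝ → ℂ) : ℂ := Function.rightLim (iteratedDeriv k φ) 1

/-- The Weyl function `W(z) = -φ_ξ(1; z) / φ_ξξ(1; z)` of type 2, for a family `φ z = φ(·; z)`. -/
noncomputable def weylW (φ : ℂ → ℝ → ℂ) (z : ℂ) : ℂ := -endValue 1 (φ z) / endValue 2 (φ z)

/-- The Weyl function `Z(z) = -φ(1; z) / φ_ξξ(1; z)` of type 2, for a family `φ z = φ(·; z)`. -/
noncomputable def weylZ (φ : ℂ → ℝ → ℂ) (z : ℂ) : ℂ := -endValue 0 (φ z) / endValue 2 (φ z)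

end CubicString

/-!
To the right of `0` the solution `φ(·; z)` is piecewise quadratic, with `φ_ξξ` jumping by
`-z gⱼ φ(ξⱼ)` at each mass, so `φ`, `φ_ξ`, `φ_ξξ` at any point to the right of the masses are real
polynomials in `z`. They satisfy
`φ(z) φ_ξξ(-z) - φ_ξ(z) φ_ξ(-z) + φ_ξξ(z) φ(-z) = 0`,
because the left side vanishes at `0`, is constant between masses, and its jumps cancel.

For `z > 0` everything is positive at `-z`, so wherever `φ_ξξ(z) = 0` the identity forces `φ(z)` and
`φ_ξ(z)` to have the same sign. When a mass is added, the new `φ_ξξ` at an old eigenvalue is a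
negative multiple of the old `φ`, so its sign alternates and the old and new eigenvalues interlace;
by induction the eigenvalues are simple and positive, with alternating signs of `φ_ξ`, and this is
the positivity of the residues `bᵢ` of `W`. The formulas for `W` and `Z` are partial fraction
expansions: by the identity at `z = yⱼ`, the residue of `Z` at `yⱼ` is `bⱼ` times `-W(-yⱼ)`, which
the expansion of `W` turns into `∑ᵢ bᵢ / (yᵢ + yⱼ)`.
-/

namespace CubicString

section TestFunctions

variable {E : Type*} [NormedAddCommGroup E] [NormedSpace ℝ E] {η : ℝ → E}

theorem contDiff_iteratedDeriv (hη : ContDiff ℝ ∞ η) (n : ℕ) :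
    ContDiff ℝ ∞ (iteratedDeriv n η) := by
  rw [iteratedDeriv_eq_iterate]
  exact hη.iterate_deriv n

theorem hasCompactSupport_iteratedDeriv (hηc : HasCompactSupport η) (n : ℕ) :
    HasCompactSupport (iteratedDeriv n η) := by
  induction n with
  | zero => rwa [iteratedDeriv_zero]
  | succ n ih => rw [iteratedDeriv_succ]; exact ih.deriv

theorem exists_hasCompactSupport_deriv_eq [CompleteSpace E] (hη : ContDiff ℝ ∞ η)
    (hηc : HasCompactSupport η) (hη0 : ∫ x, η x = 0) :
    ∃ ζ : ℝ → E, ContDiff ℝ ∞ ζ ∧ HasCompactSupport ζ ∧ deriv ζ = η := by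
  obtain ⟨R, hR⟩ := hηc.isCompact.isBounded.subset_ball 0
  rw [Real.ball_eq_Ioo, zero_sub, zero_add] at hR
  have hsupp : Function.support η ⊆ Set.Ioo (-R) R := (subset_tsupport η).trans hR
  have hderiv : ∀ x, HasDerivAt (fun x => ∫ t in -R..x, η t) (η x) x := fun x =>
    hη.continuous.integral_hasStrictDerivAt (-R) x |>.hasDerivAt
  have hderiv_eq : deriv (fun x => ∫ t in -R..x, η t) = η := funext fun x => (hderiv x).deriv
  refine ⟨fun x => ∫ t in -R..x, η t, ?_, .intro (isCompact_Icc (a := -R) (b := R)) fun x hx => ?_,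
    hderiv_eq⟩
  · exact contDiff_infty_iff_deriv.2 ⟨fun x => (hderiv x).differentiableAt, by rwa [hderiv_eq]⟩
  · rcases lt_or_ge x (-R) with hxR | hxR
    · refine intervalIntegral.integral_zero_ae (ae_of_all _ fun t ht => ?_)
      rw [Set.uIoc_of_ge hxR.le] at ht
      exact Function.notMem_support.1 fun h => (hsupp h).1.not_ge ht.2
    · have hRx : R < x := not_le.1 fun h => hx ⟨hxR, h⟩
      rwa [intervalIntegral.integral_eq_integral_of_support_subset fun t ht =>
        ⟨(hsupp ht).1, ((hsupp ht).2.trans hRx).le⟩]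

end TestFunctions

section WeakDerivatives

variable {E : Type*} [NormedAddCommGroup E] [NormedSpace ℝ E] {η : ℝ → ℝ}

theorem integrable_iteratedDeriv_smul {g : ℝ → E} (hη : ContDiff ℝ ∞ η) (hηc : HasCompactSupport η)
    (hg : Continuous g) (n : ℕ) : Integrable (fun x => iteratedDeriv n η x • g x) :=
  ((contDiff_iteratedDeriv hη n).continuous.smul hg).integrable_of_hasCompactSupport
    (hasCompactSupport_iteratedDeriv hηc n).smul_right

theorem integral_deriv_smul {g : ℝ → E} (hη : ContDiff ℝ 1 η) (hηc : HasCompactSupport η)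
    (hg : ContDiff ℝ 1 g) : ∫ x, deriv η x • g x = -∫ x, η x • deriv g x := by
  have hη' := hη.continuous_deriv_one
  have hg' := hg.continuous_deriv_one
  rw [eq_neg_iff_add_eq_zero, add_comm, ← eq_neg_iff_add_eq_zero]
  exact integral_bilinear_hasDerivAt_right_eq_neg_left_of_integrable
    (L := ContinuousLinearMap.lsmul ℝ ℝ)
    (fun x _ => (hη.differentiable_one x).hasDerivAt)
    (fun x _ => (hg.differentiable_one x).hasDerivAt)
    ((hη.continuous.smul hg').integrable_of_hasCompactSupport hηc.smul_right)
    ((hη'.smul hg.continuous).integrable_of_hasCompactSupport hηc.deriv.smul_right)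
    ((hη.continuous.smul hg.continuous).integrable_of_hasCompactSupport hηc.smul_right)

theorem integral_iteratedDeriv_smul {g : ℝ → E} {n : ℕ} (hη : ContDiff ℝ ∞ η)
    (hηc : HasCompactSupport η) (hg : ContDiff ℝ n g) :
    ∫ x, iteratedDeriv n η x • g x = (-1 : ℝ) ^ n • ∫ x, η x • iteratedDeriv n g x := by
  induction n generalizing η with
  | zero => simp
  | succ n ih =>
    have hg' : ContDiff ℝ 1 (iteratedDeriv n g) := by
      rw [iteratedDeriv_eq_iterate]
      exact ContDiff.iterate_deriv' 1 n (by rwa [add_comm])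
    rw [iteratedDeriv_succ', ih (contDiff_infty_iff_deriv.1 hη).2 hηc.deriv (hg.of_le (by simp)),
      integral_deriv_smul (hη.of_le (by simp)) hηc hg', iteratedDeriv_succ, pow_succ]
    simp

theorem iteratedDeriv_pow_smul (n i : ℕ) (a : E) (x : ℝ) :
    iteratedDeriv n (fun x : ℝ => x ^ i • a) x = (i.descFactorial n * x ^ (i - n) : ℝ) • a := by
  rw [iteratedDeriv_smul_const (by fun_prop), iteratedDeriv_pow]

theorem integral_iteratedDeriv_smul_sum_pow (hη : ContDiff ℝ ∞ η) (hηc : HasCompactSupport η)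
    {n : ℕ} (a : Fin n → E) :
    ∫ x, iteratedDeriv n η x • ∑ i : Fin n, x ^ (i : ℕ) • a i = 0 := by
  have hderiv : iteratedDeriv n (fun x : ℝ => ∑ i : Fin n, x ^ (i : ℕ) • a i) = 0 := by
    ext x
    rw [iteratedDeriv_fun_sum fun i _ => by fun_prop]
    refine Finset.sum_eq_zero fun i _ => ?_
    rw [iteratedDeriv_pow_smul, Nat.descFactorial_of_lt i.isLt]
    simp
  rw [integral_iteratedDeriv_smul hη hηc (by fun_prop), hderiv]
  simp

theorem exists_integral_iteratedDeriv_smul_eq {h : ℝ → E} (hh : Continuous h) {n : ℕ}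
    (h0 : ∀ η : ℝ → ℝ, ContDiff ℝ ∞ η → HasCompactSupport η →
      ∫ x, iteratedDeriv (n + 1) η x • h x = 0) :
    ∃ c : E, ∀ η : ℝ → ℝ, ContDiff ℝ ∞ η → HasCompactSupport η →
      ∫ x, iteratedDeriv n η x • h x = (∫ x, η x) • c := by
  let bump : ContDiffBump (0 : ℝ) := ⟨1, 2, one_pos, one_lt_two⟩
  set ρ : ℝ → ℝ := bump.normed volume
  have hρ : ContDiff ℝ ∞ ρ := bump.contDiff_normed
  have hρc : HasCompactSupport ρ := bump.hasCompactSupport_normed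
  refine ⟨∫ x, iteratedDeriv n ρ x • h x, fun η hη hηc => ?_⟩
  -- `η - (∫ η) ρ` has mean zero, so it is the derivative of a test function.
  have hmρ : ContDiff ℝ ∞ ((∫ x, η x) • ρ) := contDiff_const.smul hρ
  obtain ⟨ζ, hζ, hζc, hζη⟩ := exists_hasCompactSupport_deriv_eq (η := η - (∫ x, η x) • ρ)
    (hη.sub hmρ) (hηc.sub hρc.smul_left) <| by
      rw [integral_sub' (hη.continuous.integrable_of_hasCompactSupport hηc)
        ((hρ.continuous.integrable_of_hasCompactSupport hρc).smul _)]
      simp [integral_const_mul, ρ, bump.integral_normed]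
  have hsplit : ∀ x, iteratedDeriv (n + 1) ζ x • h x =
      iteratedDeriv n η x • h x - (∫ x, η x) • iteratedDeriv n ρ x • h x := fun x => by
    rw [iteratedDeriv_succ', hζη, iteratedDeriv_sub (hη.contDiffAt.of_le (mod_cast le_top))
      (hmρ.contDiffAt.of_le (mod_cast le_top)), iteratedDeriv_const_smul_field, sub_smul,
      smul_assoc]
  rw [← sub_eq_zero, ← integral_smul, ← integral_sub (integrable_iteratedDeriv_smul hη hηc hh n)
    ((integrable_iteratedDeriv_smul hρ hρc hh n).fun_smul _), ← h0 ζ hζ hζc]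
  exact integral_congr_ae (ae_of_all _ fun x => (hsplit x).symm)

theorem exists_eq_sum_pow_of_integral_iteratedDeriv_smul_eq_zero [CompleteSpace E] {h : ℝ → E}
    (hh : Continuous h) {n : ℕ}
    (h0 : ∀ η : ℝ → ℝ, ContDiff ℝ ∞ η → HasCompactSupport η →
      ∫ x, iteratedDeriv n η x • h x = 0) :
    ∃ a : Fin n → E, ∀ x, h x = ∑ i : Fin n, x ^ (i : ℕ) • a i := by
  induction n generalizing h with
  | zero =>
    refine ⟨Fin.elim0, fun x => ?_⟩
    have hae : h =ᵐ[volume] 0 := ae_eq_zero_of_integral_contDiff_smul_eq_zero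
      hh.locallyIntegrable fun η hη hηc => by simpa using h0 η hη hηc
    simpa using congrFun ((hh.ae_eq_iff_eq volume continuous_zero).1 hae) x
  | succ n ih =>
    obtain ⟨c, hc⟩ := exists_integral_iteratedDeriv_smul_eq hh h0
    -- The weak `n`-th derivative of `h` is the constant `(-1) ^ n • c`.
    set d : E := ((-1) ^ n / n.factorial : ℝ) • c with hd
    obtain ⟨a, ha⟩ := ih (h := fun x => h x - x ^ n • d) (by fun_prop) fun η hη hηc => by
      have hmonomial : ∫ x, iteratedDeriv n η x • x ^ n • d = (∫ x, η x) • c := by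
        rw [integral_iteratedDeriv_smul hη hηc (by fun_prop)]
        simp only [iteratedDeriv_pow_smul, Nat.descFactorial_self, tsub_self, pow_zero, mul_one]
        rw [integral_smul_const, hd, smul_smul, smul_smul, smul_smul]
        congr 1
        field_simp
        rw [← pow_mul, mul_comm n, pow_mul]
        simp
      simp only [smul_sub]
      rw [integral_sub (integrable_iteratedDeriv_smul hη hηc hh n)
        (integrable_iteratedDeriv_smul hη hηc (by fun_prop) n), hc η hη hηc, hmonomial, sub_self]
    refine ⟨Fin.snoc a d, fun x => ?_⟩
    simp only [Fin.sum_univ_castSucc, Fin.snoc_castSucc, Fin.snoc_last, Fin.val_castSucc,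
      Fin.val_last, ← ha x, sub_add_cancel]

end WeakDerivatives

section Kernel

theorem integral_Ioi_iteratedDeriv_mul_pow {η : ℝ → ℝ} (hη : ContDiff ℝ ∞ η)
    (hηc : HasCompactSupport η) (n : ℕ) (a : ℝ) :
    ∫ x in Set.Ioi a, iteratedDeriv (n + 1) η x * ((x - a) ^ n / n.factorial) =
      (-1) ^ (n + 1) * η a := by
  induction n with
  | zero =>
    simpa using hηc.integral_Ioi_deriv_eq (hη.of_le (by simp)) a
  | succ n ih =>
    set u : ℝ → ℝ := fun x => (x - a) ^ (n + 1) / (n + 1).factorial with hu_def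
    have hu : ∀ x, deriv u x = (x - a) ^ n / n.factorial := fun x => by
      rw [hu_def, deriv_div_const, deriv_fun_pow (by fun_prop), deriv_sub_const, deriv_id'']
      push_cast [Nat.factorial_succ, Nat.add_sub_cancel]
      field_simp
    have hη' := contDiff_iteratedDeriv hη (n + 1)
    have hparts := (hasCompactSupport_iteratedDeriv hηc (n + 1)).mul_right (f' := u)
      |>.integral_Ioi_deriv_eq ((hη'.of_le (by simp)).mul (by fun_prop)) a
    have hderiv : ∀ x, deriv (fun x => iteratedDeriv (n + 1) η x * u x) x =
        iteratedDeriv (n + 2) η x * u x +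
          iteratedDeriv (n + 1) η x * ((x - a) ^ n / n.factorial) := fun x => by
      rw [deriv_fun_mul (hη'.differentiable (by simp) x) (by fun_prop), hu,
        iteratedDeriv_succ (n := n + 1)]
    have hint : ∀ (k : ℕ) {v : ℝ → ℝ}, Continuous v →
        IntegrableOn (fun x => iteratedDeriv k η x * v x) (Set.Ioi a) := fun k v hv =>
      (integrable_iteratedDeriv_smul hη hηc hv k).integrableOn
    rw [integral_congr_ae (ae_of_all _ hderiv), integral_add (hint (n + 2) (by fun_prop))
      (hint (n + 1) (by fun_prop)), ih] at hparts
    have hu_a : u a = 0 := by simp [hu_def]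
    rw [hu_a, mul_zero, neg_zero, ← eq_neg_iff_add_eq_zero] at hparts
    rw [hparts]
    ring

/-- The fundamental solution `(x - a)₊² / 2` of the third derivative, with pole at `a`. -/
noncomputable def kernel (a x : ℝ) : ℝ := max (x - a) 0 ^ 2 / 2

theorem continuous_kernel (a : ℝ) : Continuous (kernel a) := by
  unfold kernel
  fun_prop

theorem kernel_of_le {a x : ℝ} (h : x ≤ a) : kernel a x = 0 := by
  simp [kernel, h]

theorem kernel_of_ge {a x : ℝ} (h : a ≤ x) : kernel a x = (x - a) ^ 2 / 2 := by
  simp [kernel, h]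

theorem integral_iteratedDeriv_three_mul_kernel {η : ℝ → ℝ} (hη : ContDiff ℝ ∞ η)
    (hηc : HasCompactSupport η) (a : ℝ) : ∫ x, iteratedDeriv 3 η x * kernel a x = -η a := by
  have hsupp : Function.support (fun x => iteratedDeriv 3 η x * kernel a x) ⊆ Set.Ioi a :=
    fun x hx => Set.mem_Ioi.2 (not_le.1 fun h => hx (by simp [kernel_of_le h]))
  rw [← setIntegral_eq_integral_of_forall_compl_eq_zero (s := Set.Ioi a) fun x hx =>
      Function.notMem_support.1 fun h => hx (hsupp h),
    setIntegral_congr_fun measurableSet_Ioi fun x hx => by rw [kernel_of_ge (le_of_lt hx)]]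
  simpa [Nat.factorial, pow_succ] using integral_Ioi_iteratedDeriv_mul_pow hη hηc 2 a

end Kernel

section PointMasses

variable {E : Type*} [NormedAddCommGroup E] {N : ℕ} {w p : Fin N → ℝ}

theorem integrable_pointMasses (f : ℝ → E) : Integrable f (pointMasses w p) :=
  integrable_finsetSum_measure.2 fun _ _ => (integrable_dirac (by simp)).smul_measure (by simp)

theorem integral_pointMasses [NormedSpace ℝ E] [CompleteSpace E] (hw : ∀ i, 0 ≤ w i) (f : ℝ → E) :
    ∫ x, f x ∂pointMasses w p = ∑ i, w i • f (p i) := by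
  rw [pointMasses, integral_finsetSum_measure
    fun _ _ => (integrable_dirac (by simp)).smul_measure (by simp)]
  refine Finset.sum_congr rfl fun i _ => ?_
  rw [integral_smul_measure, integral_dirac, ENNReal.toReal_ofReal (hw i)]

theorem integrable_pointMasses_prod {M : ℕ} {v q : Fin M → ℝ} (f : ℝ × ℝ → E) :
    Integrable f ((pointMasses w p).prod (pointMasses v q)) := by
  have hprod : (pointMasses w p).prod (pointMasses v q) = ∑ ij : Fin N × Fin M,
      (ENNReal.ofReal (w ij.1) * ENNReal.ofReal (v ij.2)) • Measure.dirac (p ij.1, q ij.2) := by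
    rw [pointMasses, pointMasses, ← Measure.sum_fintype, ← Measure.sum_fintype, Measure.prod_sum,
      Measure.sum_fintype]
    refine Finset.sum_congr rfl fun ij _ => ?_
    rw [Measure.prod_smul_left, Measure.prod_smul_right, Measure.dirac_prod_dirac, smul_smul]
  rw [hprod]
  exact integrable_finsetSum_measure.2 fun _ _ =>
    (integrable_dirac (by simp)).smul_measure (ENNReal.mul_ne_top (by simp) (by simp))

instance : SFinite (pointMasses w p) := by
  rw [pointMasses, ← Measure.sum_fintype]
  infer_instance

theorem integral_pointMasses_prod [NormedSpace ℝ E] [CompleteSpace E] {M : ℕ} {v q : Fin M → ℝ}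
    (hw : ∀ i, 0 ≤ w i) (hv : ∀ j, 0 ≤ v j) (f : ℝ × ℝ → E) :
    ∫ x, f x ∂(pointMasses w p).prod (pointMasses v q) =
      ∑ i, w i • ∑ j, v j • f (p i, q j) := by
  simp_rw [integral_prod _ (integrable_pointMasses_prod f), integral_pointMasses hv,
    integral_pointMasses hw]

end PointMasses

section VolterraEquation

variable {N : ℕ} {w p : Fin N → ℝ} {z : ℂ} {f : ℝ → ℂ}

/-- The particular solution `∑ⱼ wⱼ f(pⱼ) (x - pⱼ)₊² / 2` of `u''' = g f` for
`g = ∑ⱼ wⱼ δ_{pⱼ}`. -/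
noncomputable def massPotential (w p : Fin N → ℝ) (f : ℝ → ℂ) (x : ℝ) : ℂ :=
  ∑ j, kernel (p j) x • w j • f (p j)

theorem continuous_massPotential (w p : Fin N → ℝ) (f : ℝ → ℂ) :
    Continuous (massPotential w p f) :=
  continuous_finsetSum _ fun j _ => (continuous_kernel (p j)).smul continuous_const

theorem integral_iteratedDeriv_three_smul_massPotential (hw : ∀ i, 0 ≤ w i) {η : ℝ → ℝ}
    (hη : ContDiff ℝ ∞ η) (hηc : HasCompactSupport η) :
    ∫ x, iteratedDeriv 3 η x • massPotential w p f x = -∫ x, η x • f x ∂pointMasses w p := by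
  simp only [massPotential, Finset.smul_sum, ← smul_assoc (iteratedDeriv 3 η _)]
  rw [integral_finsetSum _ fun j _ =>
    (integrable_iteratedDeriv_smul hη hηc (continuous_kernel (p j)) 3).smul_const _,
    integral_pointMasses hw, ← Finset.sum_neg_distrib]
  refine Finset.sum_congr rfl fun j _ => ?_
  simp only [integral_smul_const, smul_eq_mul]
  rw [integral_iteratedDeriv_three_mul_kernel hη hηc, neg_smul, smul_comm]

theorem isSolution_iff_integral_eq_zero (hw : ∀ i, 0 ≤ w i) :
    IsSolution (pointMasses w p) z f ↔ Continuous f ∧ ∀ η : ℝ → ℝ, ContDiff ℝ ∞ η →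
      HasCompactSupport η → ∫ x, iteratedDeriv 3 η x • (f x + z * massPotential w p f x) = 0 := by
  have hsplit : Continuous f → ∀ η : ℝ → ℝ, ContDiff ℝ ∞ η → HasCompactSupport η →
      ∫ x, iteratedDeriv 3 η x • (f x + z * massPotential w p f x) =
        (∫ x, iteratedDeriv 3 η x • f x) - z * ∫ x, η x • f x ∂pointMasses w p := by
    intro hf η hη hηc
    have hpot := continuous_massPotential w p f
    simp only [smul_add, ← mul_smul_comm]
    rw [integral_add (integrable_iteratedDeriv_smul hη hηc hf 3)
      ((integrable_iteratedDeriv_smul hη hηc hpot 3).const_mul z), integral_const_mul,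
      integral_iteratedDeriv_three_smul_massPotential hw hη hηc, mul_neg, sub_eq_add_neg]
  refine ⟨fun h => ⟨h.continuous, fun η hη hηc => ?_⟩, fun h => ⟨h.1, fun η hη hηc => ?_⟩⟩
  · rw [hsplit h.continuous η hη hηc, h.weak_eq η hη hηc, sub_self]
  · rw [← sub_eq_zero, ← hsplit h.1 η hη hηc, h.2 η hη hηc]

theorem isSolution_iff (hw : ∀ i, 0 ≤ w i) :
    IsSolution (pointMasses w p) z f ↔ ∃ a b c : ℂ, ∀ x : ℝ,
      f x = a + b * x + c * x ^ 2 / 2 - z * massPotential w p f x := by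
  rw [isSolution_iff_integral_eq_zero hw]
  have hpot := continuous_massPotential w p f
  constructor
  · rintro ⟨hf, hweak⟩
    obtain ⟨a, ha⟩ :=
      exists_eq_sum_pow_of_integral_iteratedDeriv_smul_eq_zero (by fun_prop) hweak
    refine ⟨a 0, a 1, 2 * a 2, fun x => ?_⟩
    rw [eq_sub_iff_add_eq, ha x]
    simp only [Fin.sum_univ_three, Complex.real_smul, Fin.coe_ofNat_eq_mod]
    push_cast
    ring
  · rintro ⟨a, b, c, hform⟩
    refine ⟨by rw [funext hform]; fun_prop, fun η hη hηc => ?_⟩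
    rw [← integral_iteratedDeriv_smul_sum_pow hη hηc ![a, b, c / 2]]
    refine integral_congr_ae (ae_of_all _ fun x => congrArg (iteratedDeriv 3 η x • ·) ?_)
    rw [hform x, sub_add_cancel]
    simp only [Complex.real_smul, Fin.sum_univ_three, Fin.coe_ofNat_eq_mod, Matrix.cons_val]
    push_cast
    ring

/-- The integral equation equivalent to `-f''' = z g f`, `f(0) = f'(0) = 0`, `f''(0) = c` for
`g = ∑ⱼ wⱼ δ_{pⱼ}` carried by `(0, ∞)`. -/
def SolvesVolterra (w p : Fin N → ℝ) (z c : ℂ) (f : ℝ → ℂ) : Prop :=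
  ∀ x : ℝ, f x = c * x ^ 2 / 2 - z * massPotential w p f x

theorem massPotential_eventuallyEq_zero (hp : ∀ i, 0 < p i) :
    massPotential w p f =ᶠ[𝓝 0] 0 := by
  filter_upwards [eventually_all.2 fun i => eventually_lt_nhds (hp i)] with x hx
  simp [massPotential, kernel_of_le (hx _).le]

theorem initialValues_of_eq_sub_massPotential (hp : ∀ i, 0 < p i) {a b c : ℂ}
    (hf : ∀ x : ℝ, f x = a + b * x + c * x ^ 2 / 2 - z * massPotential w p f x) :
    f 0 = a ∧ HasDerivAt f b 0 ∧ HasDerivAt (deriv f) c 0 := by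
  have hev : f =ᶠ[𝓝 0] fun x : ℝ => a + b * x + c * x ^ 2 / 2 :=
    (massPotential_eventuallyEq_zero hp).mono fun x hx => by rw [hf x, hx]; simp
  have hderiv : ∀ x : ℝ, HasDerivAt (fun x : ℝ => a + b * x + c * x ^ 2 / 2) (b + c * x) x := by
    intro x
    have hx : HasDerivAt (fun x : ℝ => (x : ℂ)) 1 x := Complex.ofRealCLM.hasDerivAt
    convert! ((hx.const_mul b).const_add a).add (((hx.fun_pow 2).const_mul c).div_const 2) using 1
    push_cast
    ring
  have hderiv' : HasDerivAt (fun x : ℝ => b + c * x) c 0 := by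
    simpa using ((hasDerivAt_id (0 : ℝ)).ofReal_comp.const_mul c).const_add b
  refine ⟨by simpa using hev.eq_of_nhds, ?_, ?_⟩
  · simpa using (hderiv 0).congr_of_eventuallyEq hev
  · exact hderiv'.congr_of_eventuallyEq
      (hev.deriv.trans (.of_eq (funext fun x => (hderiv x).deriv)))

theorem solvesVolterra_iff (hw : ∀ i, 0 ≤ w i) (hp : ∀ i, 0 < p i) {c : ℂ} :
    SolvesVolterra w p z c f ↔ IsSolution (pointMasses w p) z f ∧ f 0 = 0 ∧ HasDerivAt f 0 0 ∧
      HasDerivAt (deriv f) c 0 := by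
  rw [isSolution_iff hw]
  constructor
  · intro h
    have hform : ∀ x : ℝ, f x = 0 + 0 * x + c * x ^ 2 / 2 - z * massPotential w p f x := by
      simpa [SolvesVolterra] using h
    exact ⟨⟨0, 0, c, hform⟩, initialValues_of_eq_sub_massPotential hp hform⟩
  · rintro ⟨⟨a, b, c', hform⟩, h0, h1, h2⟩
    obtain ⟨h0', h1', h2'⟩ := initialValues_of_eq_sub_massPotential hp hform
    rw [← h0', h0, h1'.unique h1, h2'.unique h2] at hform
    simpa [SolvesVolterra] using hform

theorem isIVPSolution_iff (hw : ∀ i, 0 ≤ w i) (hp : ∀ i, 0 < p i) :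
    IsIVPSolution (pointMasses w p) z f ↔ SolvesVolterra w p z 1 f := by
  rw [solvesVolterra_iff hw hp]
  exact ⟨fun h => ⟨h.toIsSolution, h.val_zero, h.deriv_zero, h.deriv2_zero⟩,
    fun h => ⟨h.1, h.2.1, h.2.2.1, h.2.2.2⟩⟩

theorem exists_solvesVolterra (hw : ∀ i, 0 ≤ w i) (hp : ∀ i, 0 < p i)
    (hf : IsSolution (pointMasses w p) z f) (h0 : f 0 = 0) (h1 : HasDerivAt f 0 0) :
    ∃ c, SolvesVolterra w p z c f := by
  obtain ⟨a, b, c, hform⟩ := (isSolution_iff hw).1 hf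
  exact ⟨c, (solvesVolterra_iff hw hp).2
    ⟨hf, h0, h1, (initialValues_of_eq_sub_massPotential hp hform).2.2⟩⟩

end VolterraEquation

open Polynomial

section SolutionPolynomials

variable {N : ℕ}

/-- To the right of the masses `w` at `p`, the solution `φ(x; z)` of the initial value problem is a
polynomial in `z`. It is built up mass by mass from the left; `slopePoly` and `curvaturePoly` do
the same for `φ_ξ(x; z)` and `φ_ξξ(x; z)`, the latter being independent of `x`. -/
noncomputable def valuePoly : {N : ℕ} → (w p : Fin N → ℝ) → ℝ → ℝ[X]
  | 0, _, _, x => C (x ^ 2 / 2)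
  | N + 1, w, p, x => valuePoly (Fin.init w) (Fin.init p) x -
      C (w (Fin.last N) * (x - p (Fin.last N)) ^ 2 / 2) *
        (X * valuePoly (Fin.init w) (Fin.init p) (p (Fin.last N)))

/-- The polynomial `z ↦ φ_ξ(x; z)` to the right of the masses `w` at `p`. -/
noncomputable def slopePoly : {N : ℕ} → (w p : Fin N → ℝ) → ℝ → ℝ[X]
  | 0, _, _, x => C x
  | N + 1, w, p, x => slopePoly (Fin.init w) (Fin.init p) x -
      C (w (Fin.last N) * (x - p (Fin.last N))) *
        (X * valuePoly (Fin.init w) (Fin.init p) (p (Fin.last N)))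

/-- The polynomial `z ↦ φ_ξξ(x; z)` to the right of the masses `w` at `p`. -/
noncomputable def curvaturePoly : {N : ℕ} → (w p : Fin N → ℝ) → ℝ[X]
  | 0, _, _ => 1
  | N + 1, w, p => curvaturePoly (Fin.init w) (Fin.init p) -
      C (w (Fin.last N)) * (X * valuePoly (Fin.init w) (Fin.init p) (p (Fin.last N)))

theorem slopePoly_eq_taylor (w p : Fin N → ℝ) (a x : ℝ) :
    slopePoly w p x = slopePoly w p a + C (x - a) * curvaturePoly w p := by
  induction N with
  | zero => simp [slopePoly, curvaturePoly]
  | succ N ih =>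
    simp only [slopePoly, curvaturePoly, ih (Fin.init w) (Fin.init p), C_mul, C_sub]
    ring

theorem valuePoly_eq_taylor (w p : Fin N → ℝ) (a x : ℝ) :
    valuePoly w p x = valuePoly w p a + C (x - a) * slopePoly w p a +
      C ((x - a) ^ 2 / 2) * curvaturePoly w p := by
  induction N with
  | zero =>
    simp only [valuePoly, slopePoly, curvaturePoly, mul_one, ← C_mul, ← C_add]
    ring_nf
  | succ N ih =>
    refine Polynomial.funext fun t => ?_
    simp only [valuePoly, slopePoly, curvaturePoly, ih (Fin.init w) (Fin.init p), eval_add,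
      eval_sub, eval_mul, eval_C, eval_X]
    ring

theorem hasDerivAt_aeval_valuePoly (w p : Fin N → ℝ) (z : ℂ) (x : ℝ) :
    HasDerivAt (fun x => aeval z (valuePoly w p x)) (aeval z (slopePoly w p x)) x := by
  have hshift : HasDerivAt (fun t : ℝ => ((t - x : ℝ) : ℂ)) 1 x := by
    simpa using ((hasDerivAt_id x).sub_const x).ofReal_comp
  have htaylor : (fun t => aeval z (valuePoly w p t)) = fun t =>
      aeval z (valuePoly w p x) + ((t - x : ℝ) : ℂ) * aeval z (slopePoly w p x) +
        ((t - x : ℝ) : ℂ) ^ 2 / 2 * aeval z (curvaturePoly w p) := by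
    ext t
    rw [valuePoly_eq_taylor w p x t]
    simp
  rw [htaylor]
  convert! ((hshift.mul_const _).const_add _).add
    (((hshift.fun_pow 2).div_const 2).mul_const (aeval z (curvaturePoly w p))) using 1
  simp

theorem hasDerivAt_aeval_slopePoly (w p : Fin N → ℝ) (z : ℂ) (x : ℝ) :
    HasDerivAt (fun x => aeval z (slopePoly w p x)) (aeval z (curvaturePoly w p)) x := by
  have hshift : HasDerivAt (fun t : ℝ => ((t - x : ℝ) : ℂ)) 1 x := by
    simpa using ((hasDerivAt_id x).sub_const x).ofReal_comp
  have htaylor : (fun t => aeval z (slopePoly w p t)) = fun t =>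
      aeval z (slopePoly w p x) + ((t - x : ℝ) : ℂ) * aeval z (curvaturePoly w p) := by
    ext t
    rw [slopePoly_eq_taylor w p x t]
    simp
  rw [htaylor]
  convert! (hshift.mul_const (aeval z (curvaturePoly w p))).const_add _ using 1
  simp

theorem valuePoly_last (w p : Fin (N + 1) → ℝ) :
    valuePoly w p (p (Fin.last N)) =
      valuePoly (Fin.init w) (Fin.init p) (p (Fin.last N)) := by
  simp [valuePoly]

theorem slopePoly_last (w p : Fin (N + 1) → ℝ) :
    slopePoly w p (p (Fin.last N)) =
      slopePoly (Fin.init w) (Fin.init p) (p (Fin.last N)) := by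
  simp [slopePoly]

theorem natDegree_sub_C_mul_X_mul_le {R : Type*} [Ring R] {P Q : R[X]} (hP : P.natDegree ≤ N)
    (hQ : Q.natDegree ≤ N) (c : R) : (P - C c * (X * Q)).natDegree ≤ N + 1 :=
  natDegree_sub_le_of_le (hP.trans N.le_succ) ((natDegree_C_mul_le _ _).trans
    ((natDegree_mul_le_of_le natDegree_X_le hQ).trans (add_comm 1 N).le)) |>.trans (max_self _).le

theorem natDegree_valuePoly_le (w p : Fin N → ℝ) (x : ℝ) : (valuePoly w p x).natDegree ≤ N := by
  induction N generalizing x with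
  | zero => simp [valuePoly]
  | succ N ih => exact natDegree_sub_C_mul_X_mul_le (ih _ _ x) (ih _ _ _) _

theorem natDegree_slopePoly_le (w p : Fin N → ℝ) (x : ℝ) : (slopePoly w p x).natDegree ≤ N := by
  induction N with
  | zero => simp [slopePoly]
  | succ N ih => exact natDegree_sub_C_mul_X_mul_le (ih _ _) (natDegree_valuePoly_le _ _ _) _

theorem natDegree_curvaturePoly_le (w p : Fin N → ℝ) : (curvaturePoly w p).natDegree ≤ N := by
  induction N with
  | zero => simp [curvaturePoly]
  | succ N ih => exact natDegree_sub_C_mul_X_mul_le (ih _ _) (natDegree_valuePoly_le _ _ _) _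

theorem eval_zero_curvaturePoly (w p : Fin N → ℝ) : (curvaturePoly w p).eval 0 = 1 := by
  induction N with
  | zero => simp [curvaturePoly]
  | succ N ih => simp [curvaturePoly, ih]

theorem bilinear_concomitant_eq_zero (w p : Fin N → ℝ) (x t : ℝ) :
    (valuePoly w p x).eval t * (curvaturePoly w p).eval (-t) -
      (slopePoly w p x).eval t * (slopePoly w p x).eval (-t) +
      (curvaturePoly w p).eval t * (valuePoly w p x).eval (-t) = 0 := by
  induction N generalizing x with
  | zero => 
    simp only [valuePoly, slopePoly, curvaturePoly, eval_C, eval_one]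
    ring
  | succ N ih =>
    have hmass := ih (Fin.init w) (Fin.init p) (p (Fin.last N))
    simp only [valuePoly, slopePoly, curvaturePoly, eval_sub, eval_mul, eval_C, eval_X, eval_add,
      valuePoly_eq_taylor _ _ (p (Fin.last N)) x, slopePoly_eq_taylor _ _ (p (Fin.last N)) x]
    linear_combination hmass

theorem eval_neg_valuePoly_nonneg {w p : Fin N → ℝ} (hw : ∀ i, 0 ≤ w i) {t : ℝ} (ht : 0 ≤ t)
    (x : ℝ) : 0 ≤ (valuePoly w p x).eval (-t) := by
  induction N generalizing x with
  | zero => simpa [valuePoly] using by positivity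
  | succ N ih =>
    have hx := ih (w := Fin.init w) (p := Fin.init p) (fun i => hw i.castSucc)
    have hmass := hx (p (Fin.last N))
    have := hw (Fin.last N)
    simp only [valuePoly, eval_sub, eval_mul, eval_C, eval_X, neg_mul, mul_neg, sub_neg_eq_add]
    exact add_nonneg (hx x) (by positivity)

theorem le_eval_neg_slopePoly {w p : Fin N → ℝ} (hw : ∀ i, 0 ≤ w i) {t : ℝ} (ht : 0 ≤ t) {x : ℝ}
    (hx : ∀ i, p i ≤ x) : x ≤ (slopePoly w p x).eval (-t) := by
  induction N with
  | zero => simp [slopePoly]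
  | succ N ih =>
    have hslope := ih (w := Fin.init w) (p := Fin.init p) (fun i => hw i.castSucc)
      (fun i => hx i.castSucc)
    have hmass := eval_neg_valuePoly_nonneg (w := Fin.init w) (p := Fin.init p)
      (fun i => hw i.castSucc) ht (p (Fin.last N))
    have := hw (Fin.last N)
    have := sub_nonneg.2 (hx (Fin.last N))
    simp only [slopePoly, eval_sub, eval_mul, eval_C, eval_X, neg_mul, mul_neg, sub_neg_eq_add]
    exact hslope.trans (le_add_of_nonneg_right (by positivity))

theorem one_le_eval_neg_curvaturePoly {w p : Fin N → ℝ} (hw : ∀ i, 0 ≤ w i) {t : ℝ} (ht : 0 ≤ t) :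
    1 ≤ (curvaturePoly w p).eval (-t) := by
  induction N with
  | zero => simp [curvaturePoly]
  | succ N ih =>
    have hcurv := ih (w := Fin.init w) (p := Fin.init p) (fun i => hw i.castSucc)
    have hmass := eval_neg_valuePoly_nonneg (w := Fin.init w) (p := Fin.init p)
      (fun i => hw i.castSucc) ht (p (Fin.last N))
    have := hw (Fin.last N)
    simp only [curvaturePoly, eval_sub, eval_mul, eval_C, eval_X, neg_mul, mul_neg, sub_neg_eq_add]
    exact hcurv.trans (le_add_of_nonneg_right (by positivity))

theorem neg_one_pow_mul_coeff_valuePoly_pos {w p : Fin N → ℝ} (hw : ∀ i, 0 < w i)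
    (hp0 : ∀ i, 0 < p i) (hp : StrictMono p) {x : ℝ} (hx0 : 0 < x) (hx : ∀ i, p i < x) :
    0 < (-1) ^ N * (valuePoly w p x).coeff N := by
  induction N generalizing x with
  | zero => simpa [valuePoly] using pow_pos hx0 2
  | succ N ih =>
    have hmass := ih (w := Fin.init w) (p := Fin.init p) (fun i => hw i.castSucc)
      (fun i => hp0 i.castSucc) (hp.comp Fin.strictMono_castSucc) (hp0 (Fin.last N))
      (fun i => hp (Fin.castSucc_lt_last i))
    have htop : (valuePoly (Fin.init w) (Fin.init p) x).coeff (N + 1) = 0 :=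
      coeff_eq_zero_of_natDegree_lt (Nat.lt_succ_of_le (natDegree_valuePoly_le _ _ _))
    have hlast := sub_pos.2 (hx (Fin.last N))
    have hw_last := hw (Fin.last N)
    simp only [valuePoly, coeff_sub, coeff_C_mul, coeff_X_mul, htop]
    calc 0 < w (Fin.last N) * (x - p (Fin.last N)) ^ 2 / 2 * ((-1) ^ N *
        (valuePoly (Fin.init w) (Fin.init p) (p (Fin.last N))).coeff N) := by
          positivity
      _ = _ := by ring

theorem neg_one_pow_mul_coeff_curvaturePoly_pos {w p : Fin N → ℝ} (hw : ∀ i, 0 < w i)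
    (hp0 : ∀ i, 0 < p i) (hp : StrictMono p) : 0 < (-1) ^ N * (curvaturePoly w p).coeff N := by
  cases N with
  | zero => simp [curvaturePoly]
  | succ N =>
    have hmass := neg_one_pow_mul_coeff_valuePoly_pos (w := Fin.init w) (p := Fin.init p)
      (fun i => hw i.castSucc) (fun i => hp0 i.castSucc) (hp.comp Fin.strictMono_castSucc)
      (hp0 (Fin.last N)) (fun i => hp (Fin.castSucc_lt_last i))
    have htop : (curvaturePoly (Fin.init w) (Fin.init p)).coeff (N + 1) = 0 :=
      coeff_eq_zero_of_natDegree_lt (Nat.lt_succ_of_le (natDegree_curvaturePoly_le _ _))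
    have hw_last := hw (Fin.last N)
    simp only [curvaturePoly, coeff_sub, coeff_C_mul, coeff_X_mul, htop]
    calc 0 < w (Fin.last N) * ((-1) ^ N *
        (valuePoly (Fin.init w) (Fin.init p) (p (Fin.last N))).coeff N) := by
          positivity
      _ = _ := by ring

end SolutionPolynomials

section SolutionFormula

variable {N : ℕ} {z c : ℂ} {f : ℝ → ℂ}

theorem massPotential_succ (w p : Fin (N + 1) → ℝ) (f : ℝ → ℂ) (x : ℝ) :
    massPotential w p f x = massPotential (Fin.init w) (Fin.init p) f x +
      kernel (p (Fin.last N)) x • w (Fin.last N) • f (p (Fin.last N)) :=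
  Fin.sum_univ_castSucc _

theorem solvesVolterra_succ_iff {w p : Fin (N + 1) → ℝ} (hp : Monotone p) :
    SolvesVolterra w p z c f ↔ SolvesVolterra (Fin.init w) (Fin.init p) z c fun x =>
      f x + z * kernel (p (Fin.last N)) x • w (Fin.last N) • f (p (Fin.last N)) := by
  refine forall_congr' fun x => ?_
  have hinit : massPotential (Fin.init w) (Fin.init p) (fun x =>
      f x + z * kernel (p (Fin.last N)) x • w (Fin.last N) • f (p (Fin.last N))) x =
        massPotential (Fin.init w) (Fin.init p) f x := by
    refine Finset.sum_congr rfl fun j _ => ?_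
    simp [Fin.init, kernel_of_le (hp (Fin.le_last j.castSucc))]
  rw [massPotential_succ, hinit, mul_add, ← sub_sub, eq_sub_iff_add_eq]

theorem existsUnique_solvesVolterra {w p : Fin N → ℝ} (hp : Monotone p) (z c : ℂ) :
    ∃! f, SolvesVolterra w p z c f := by
  induction N with
  | zero => exact ⟨fun x => c * x ^ 2 / 2, by simp [SolvesVolterra, massPotential],
      fun f hf => funext fun x => by simpa [massPotential] using hf x⟩
  | succ N ih =>
    obtain ⟨g, hg, huniq⟩ :=
      ih (w := Fin.init w) (p := Fin.init p) (hp.comp Fin.strictMono_castSucc.monotone)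
    refine ⟨fun x => g x - z * kernel (p (Fin.last N)) x • w (Fin.last N) • g (p (Fin.last N)),
      (solvesVolterra_succ_iff hp).2 ?_, fun f hf => ?_⟩
    · simpa [kernel_of_le] using hg
    · have hfg := huniq _ ((solvesVolterra_succ_iff hp).1 hf)
      have hlast : g (p (Fin.last N)) = f (p (Fin.last N)) := by
        simp [← hfg, kernel_of_le]
      funext x
      rw [hlast, ← hfg, add_sub_cancel_right]

theorem SolvesVolterra.eq_aeval_valuePoly {w p : Fin N → ℝ} (hp : Monotone p)
    (hf : SolvesVolterra w p z c f) {x : ℝ} (hx : ∀ i, p i ≤ x) :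
    f x = c * aeval z (valuePoly w p x) := by
  induction N generalizing f x with
  | zero => simp [hf x, massPotential, valuePoly, mul_div_assoc]
  | succ N ih =>
    have hinit := fun y hy => ih (w := Fin.init w) (p := Fin.init p)
      (hp.comp Fin.strictMono_castSucc.monotone) ((solvesVolterra_succ_iff hp).1 hf) (x := y) hy
    have hlast := hinit (p (Fin.last N)) fun i => hp (Fin.le_last _)
    rw [kernel_of_le le_rfl, zero_smul, mul_zero, add_zero] at hlast
    have hvalue := hinit x fun i => hx _
    rw [hlast, kernel_of_ge (hx (Fin.last N)), ← eq_sub_iff_add_eq] at hvalue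
    rw [hvalue, valuePoly]
    simp only [map_sub, map_mul, aeval_C, aeval_X, Complex.coe_algebraMap, Complex.real_smul]
    push_cast
    ring

theorem iteratedDeriv_aeval_valuePoly (w p : Fin N → ℝ) (z c : ℂ) (k : Fin 3) :
    iteratedDeriv k (fun x => c * aeval z (valuePoly w p x)) =
      fun x => c * aeval z (![valuePoly w p x, slopePoly w p x, curvaturePoly w p] k) := by
  have hslope : deriv (fun x => c * aeval z (valuePoly w p x)) =
      fun x => c * aeval z (slopePoly w p x) :=
    funext fun x => ((hasDerivAt_aeval_valuePoly w p z x).const_mul c).deriv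
  have hcurv : deriv (fun x => c * aeval z (slopePoly w p x)) =
      fun _ => c * aeval z (curvaturePoly w p) :=
    funext fun x => ((hasDerivAt_aeval_slopePoly w p z x).const_mul c).deriv
  fin_cases k <;> simp [iteratedDeriv_succ, hslope, hcurv]

theorem SolvesVolterra.tendsto_iteratedDeriv {w p : Fin N → ℝ} (hp : Monotone p)
    (hf : SolvesVolterra w p z c f) {s : ℝ} (hs : ∀ i, p i ≤ s) (k : Fin 3) :
    Tendsto (iteratedDeriv k f) (𝓝[>] s)
      (𝓝 (c * aeval z (![valuePoly w p s, slopePoly w p s, curvaturePoly w p] k))) := by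
  have hcont : ContinuousAt (fun x =>
      c * aeval z (![valuePoly w p x, slopePoly w p x, curvaturePoly w p] k)) s := by
    refine continuousAt_const.mul ?_
    fin_cases k
    · exact (hasDerivAt_aeval_valuePoly w p z s).continuousAt
    · exact (hasDerivAt_aeval_slopePoly w p z s).continuousAt
    · exact continuousAt_const
  refine (hcont.tendsto.mono_left nhdsWithin_le_nhds).congr' ?_
  filter_upwards [self_mem_nhdsWithin] with x hx
  have hev : f =ᶠ[𝓝 x] fun x => c * aeval z (valuePoly w p x) := by
    filter_upwards [Ioi_mem_nhds hx] with t ht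
    exact hf.eq_aeval_valuePoly hp fun i => (hs i).trans (le_of_lt ht)
  rw [hev.iteratedDeriv_eq, iteratedDeriv_aeval_valuePoly]

theorem SolvesVolterra.endValue_eq {w p : Fin N → ℝ} (hp : Monotone p) (hp1 : ∀ i, p i ≤ 1)
    (hf : SolvesVolterra w p z c f) (k : Fin 3) :
    endValue k f = c * aeval z (![valuePoly w p 1, slopePoly w p 1, curvaturePoly w p] k) :=
  rightLim_eq_of_tendsto (hf.tendsto_iteratedDeriv hp hp1 k)

theorem mem_spectrumType2_iff {w p : Fin N → ℝ} (hw : ∀ i, 0 ≤ w i) (hp : Monotone p)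
    (hp0 : ∀ i, 0 < p i) (hp1 : ∀ i, p i ≤ 1) :
    z ∈ spectrumType2 (pointMasses w p) ↔ aeval z (curvaturePoly w p) = 0 := by
  constructor
  · rintro ⟨f, hf, hne, h0, h1, h2⟩
    obtain ⟨c, hc⟩ := exists_solvesVolterra hw hp0 hf h0 h1
    have hc0 : c ≠ 0 := by
      rintro rfl
      refine hne ((existsUnique_solvesVolterra hp z 0).unique hc fun x => ?_)
      simp [massPotential]
    have hlim := tendsto_nhds_unique (hc.tendsto_iteratedDeriv hp hp1 2) h2
    exact (mul_eq_zero.1 hlim).resolve_left hc0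
  · intro hz
    obtain ⟨f, hf, -⟩ := existsUnique_solvesVolterra (w := w) hp z 1
    obtain ⟨hsol, h0, h1, h2⟩ := (solvesVolterra_iff hw hp0).1 hf
    refine ⟨f, hsol, ?_, h0, h1, by simpa [hz] using hf.tendsto_iteratedDeriv hp hp1 2⟩
    rintro rfl
    have hderiv : deriv (0 : ℝ → ℂ) = fun _ => 0 := funext fun x => deriv_const x (0 : ℂ)
    rw [hderiv] at h2
    exact one_ne_zero (h2.unique (hasDerivAt_const 0 0))

end SolutionFormula

section SignChanges

theorem eventually_eval_pos {𝕜 : Type*} [NormedField 𝕜] [LinearOrder 𝕜] [IsStrictOrderedRing 𝕜]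
    [OrderTopology 𝕜] {P : 𝕜[X]} (hP : 0 < P.leadingCoeff) : ∀ᶠ x in atTop, 0 < P.eval x := by
  rcases le_or_gt P.degree 0 with hdeg | hdeg
  · have hconst := eq_C_of_degree_le_zero hdeg
    rw [hconst, leadingCoeff_C] at hP
    rw [hconst]
    exact .of_forall fun x => by rwa [eval_C]
  · exact (P.tendsto_atTop_of_leadingCoeff_nonneg hdeg hP.le).eventually_gt_atTop 0

theorem strictMono_snoc {α : Type*} [Preorder α] {n : ℕ} {f : Fin n → α} {a : α}
    (hf : StrictMono f) (ha : ∀ i, f i < a) : StrictMono (Fin.snoc f a : Fin (n + 1) → α) := by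
  rw [← Fin.insertNth_last', Fin.strictMono_insertNth_iff]
  exact ⟨hf, fun i _ => ha i, fun i hi => absurd hi (Fin.castSucc_lt_last i).not_ge⟩

theorem exists_zeros_of_alternating_signs {k : ℕ} {f : ℝ → ℝ} (hf : Continuous f)
    {t : Fin (k + 1) → ℝ} (ht : StrictMono t)
    (hsign : ∀ i : Fin (k + 1), 0 < (-1) ^ (i : ℕ) * f (t i)) :
    ∃ u : Fin k → ℝ, ∀ i, u i ∈ Set.Ioo (t i.castSucc) (t i.succ) ∧ f (u i) = 0 := by
  have hroot : ∀ i : Fin k, ∃ u ∈ Set.Ioo (t i.castSucc) (t i.succ), f u = 0 := by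
    intro i
    have hleft : 0 < (-1) ^ (i : ℕ) * f (t i.castSucc) := by simpa using hsign i.castSucc
    have hright : (-1) ^ (i : ℕ) * f (t i.succ) < 0 := by
      simpa [pow_succ] using hsign i.succ
    obtain ⟨u, hu, hfu⟩ := intermediate_value_Ioo' (ht i.castSucc_lt_succ).le
      (f := fun x => (-1) ^ (i : ℕ) * f x) (by fun_prop) ⟨hright, hleft⟩
    exact ⟨u, hu, (mul_eq_zero.1 hfu).resolve_left (by simp)⟩
  choose u hu hfu using hroot
  exact ⟨u, fun i => ⟨hu i, hfu i⟩⟩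

theorem neg_one_pow_mul_prod_pos {R : Type*} [CommRing R] [LinearOrder R] [IsStrictOrderedRing R]
    {N : ℕ} {g : Fin N → R} {j : Fin (N + 1)}
    (hneg : ∀ i : Fin N, i.castSucc < j → g i < 0) (hpos : ∀ i : Fin N, j ≤ i.castSucc → 0 < g i) :
    0 < (-1) ^ (j : ℕ) * ∏ i, g i := by
  have hcard : Finset.card {i : Fin N | (i : ℕ) < j} = j := by
    rw [Fin.card_filter_val_lt, min_eq_right (Nat.le_of_lt_succ j.is_lt)]
  have hsigns : (-1 : R) ^ (j : ℕ) = ∏ i : Fin N, if (i : ℕ) < j then -1 else 1 := by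
    rw [Finset.prod_ite, Finset.prod_const, Finset.prod_const_one, mul_one, hcard]
  rw [hsigns, ← Finset.prod_mul_distrib]
  refine Finset.prod_pos fun i _ => ?_
  split_ifs with hi
  · simpa using hneg i hi
  · simpa using hpos i (not_lt.1 hi)

theorem eq_prod_one_sub_of_eval_eq_zero {K : Type*} [Field K] {N : ℕ} {P : K[X]}
    (hdeg : P.natDegree ≤ N) (hP0 : P.eval 0 = 1) {u : Fin N → K} (hu : Function.Injective u)
    (hu0 : ∀ i, u i ≠ 0) (hroot : ∀ i, P.eval (u i) = 0) :
    P = ∏ i, (1 - C (u i)⁻¹ * X) := by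
  have hnodes : Function.Injective (Fin.cons 0 u : Fin (N + 1) → K) :=
    Fin.cons_injective_iff.2 ⟨by rintro ⟨i, hi⟩; exact hu0 i hi, hu⟩
  have hdeg_prod : (∏ i, (1 - C (u i)⁻¹ * X)).natDegree ≤ N := by
    refine (natDegree_prod_le _ _).trans ((Finset.sum_le_card_nsmul _ _ 1 fun i _ => ?_).trans ?_)
    · compute_degree
    · simp
  have hlt : ∀ Q : K[X], Q.natDegree ≤ N → Q.degree < (Finset.univ : Finset (Fin (N + 1))).card :=
    fun Q hQ => degree_le_natDegree.trans_lt (by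
      rw [Finset.card_univ, Fintype.card_fin]
      exact mod_cast Nat.lt_succ_of_le hQ)
  refine eq_of_degrees_lt_of_eval_index_eq Finset.univ hnodes.injOn (hlt _ hdeg)
    (hlt _ hdeg_prod) fun i _ => ?_
  cases i using Fin.cases with
  | zero => simp [hP0, eval_prod]
  | succ i =>
    rw [Fin.cons_succ, hroot, eval_prod, Finset.prod_eq_zero (Finset.mem_univ i)]
    simp [hu0 i]

theorem neg_one_pow_mul_eval_prod_one_sub_pos {K : Type*} [Field K] [LinearOrder K]
    [IsStrictOrderedRing K] {N : ℕ} {y : Fin N → K} (hy : ∀ i, 0 < y i) {j : Fin (N + 1)} {t : K}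
    (hlt : ∀ i : Fin N, i.castSucc < j → y i < t)
    (hgt : ∀ i : Fin N, j ≤ i.castSucc → t < y i) :
    0 < (-1) ^ (j : ℕ) * (∏ i, (1 - C (y i)⁻¹ * X)).eval t := by
  simp only [eval_prod, eval_sub, eval_one, eval_mul, eval_C, eval_X]
  refine neg_one_pow_mul_prod_pos (fun i hi => sub_neg.2 ?_) fun i hi => sub_pos.2 ?_
  · rw [inv_mul_eq_div, one_lt_div (hy i)]
    exact hlt i hi
  · rw [inv_mul_eq_div, div_lt_one (hy i)]
    exact hgt i hi

theorem neg_one_pow_mul_eval_derivative_prod_one_sub_neg {K : Type*} [Field K] [LinearOrder K]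
    [IsStrictOrderedRing K] {N : ℕ} {y : Fin N → K} (hy : ∀ i, 0 < y i)
    (hmono : StrictMono y) (j : Fin N) :
    (-1) ^ (j : ℕ) * (∏ i, (1 - C (y i)⁻¹ * X)).derivative.eval (y j) < 0 := by
  cases N with
  | zero => exact j.elim0
  | succ N =>
    have hrest : 0 < (-1) ^ (j : ℕ) *
        (∏ i, (1 - C (y (j.succAbove i))⁻¹ * X)).eval (y j) :=
      neg_one_pow_mul_eval_prod_one_sub_pos (fun i => hy _)
        (fun i hi => hmono (Fin.succAbove_lt_iff_castSucc_lt _ _ |>.2 hi))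
        (fun i hi => hmono (Fin.lt_succAbove_iff_le_castSucc _ _ |>.2 hi))
    rw [Fin.prod_univ_succAbove _ j]
    have hyj := inv_pos.2 (hy j)
    simp only [derivative_mul, derivative_sub, derivative_one, derivative_C, derivative_X, eval_add,
      eval_sub, eval_mul, eval_C, eval_X, eval_one, eval_zero]
    rw [inv_mul_cancel₀ (hy j).ne']
    nlinarith

end SignChanges

section Interlacing

variable {N : ℕ}

/-- `y` lists the type 2 eigenvalues of the string with masses `w` at `p`. The sign condition on
`φ_ξ(·; yᵢ)`, which does not depend on the position since `φ_ξξ(·; yᵢ) = 0` to the right of the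
masses, is what drives the induction on the number of masses and makes the Weyl residues
positive. -/
structure IsSpectralSequence (w p y : Fin N → ℝ) : Prop where
  strictMono : StrictMono y
  pos : ∀ i, 0 < y i
  curvaturePoly_eq : curvaturePoly w p = ∏ i, (1 - C (y i)⁻¹ * X)
  slopePoly_sign : ∀ (i : Fin N) (x : ℝ), 0 < (-1) ^ (i : ℕ) * (slopePoly w p x).eval (y i)

theorem IsSpectralSequence.eval_curvaturePoly {w p y : Fin N → ℝ} (h : IsSpectralSequence w p y)
    (i : Fin N) : (curvaturePoly w p).eval (y i) = 0 := by
  rw [h.curvaturePoly_eq, eval_prod, Finset.prod_eq_zero (Finset.mem_univ i)]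
  simp [(h.pos i).ne']

theorem mul_eval_slopePoly_pos_iff {w p : Fin N → ℝ} (hw : ∀ i, 0 ≤ w i) {x t s : ℝ} (hx0 : 0 < x)
    (hx : ∀ i, p i ≤ x) (ht : 0 ≤ t) (hroot : (curvaturePoly w p).eval t = 0) :
    0 < s * (slopePoly w p x).eval t ↔ 0 < s * (valuePoly w p x).eval t := by
  have hconcomitant := bilinear_concomitant_eq_zero w p x t
  have hslope := hx0.trans_le (le_eval_neg_slopePoly hw ht hx)
  have hcurv := zero_lt_one.trans_le (one_le_eval_neg_curvaturePoly (p := p) hw ht)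
  rw [hroot, zero_mul, add_zero, sub_eq_zero] at hconcomitant
  rw [← mul_pos_iff_of_pos_right hslope, mul_assoc, ← hconcomitant, ← mul_assoc,
    mul_pos_iff_of_pos_right hcurv]

theorem eval_slopePoly_eq_of_eval_curvaturePoly_eq_zero {w p : Fin N → ℝ} {t : ℝ}
    (hroot : (curvaturePoly w p).eval t = 0) (x x' : ℝ) :
    (slopePoly w p x).eval t = (slopePoly w p x').eval t := by
  rw [slopePoly_eq_taylor w p x' x, eval_add, eval_mul, hroot, mul_zero, add_zero]

theorem eventually_neg_one_pow_mul_eval_curvaturePoly_pos {w p : Fin N → ℝ} (hw : ∀ i, 0 < w i)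
    (hp0 : ∀ i, 0 < p i) (hp : StrictMono p) :
    ∀ᶠ t in atTop, 0 < (-1) ^ N * (curvaturePoly w p).eval t := by
  have hcoeff := neg_one_pow_mul_coeff_curvaturePoly_pos hw hp0 hp
  have hdeg : (curvaturePoly w p).natDegree = N := natDegree_eq_of_le_of_coeff_ne_zero
    (natDegree_curvaturePoly_le w p) (right_ne_zero_of_mul hcoeff.ne')
  have hlead : 0 < (C ((-1) ^ N) * curvaturePoly w p).leadingCoeff := by
    rwa [leadingCoeff_mul, leadingCoeff_C, leadingCoeff, hdeg]
  simpa only [eval_mul, eval_C] using eventually_eval_pos hlead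

theorem IsSpectralSequence.neg_one_pow_mul_eval_curvaturePoly_succ_pos {w p : Fin (N + 1) → ℝ}
    (hw : ∀ i, 0 < w i) (hp0 : 0 < p (Fin.last N)) (hp : Monotone p) {y : Fin N → ℝ}
    (h : IsSpectralSequence (Fin.init w) (Fin.init p) y) (i : Fin N) :
    0 < (-1) ^ (i + 1 : ℕ) * (curvaturePoly w p).eval (y i) := by
  have hvalue : 0 < (-1) ^ (i : ℕ) *
      (valuePoly (Fin.init w) (Fin.init p) (p (Fin.last N))).eval (y i) :=
    (mul_eval_slopePoly_pos_iff (fun i => (hw i.castSucc).le) hp0 (fun i => hp (Fin.le_last _))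
      (h.pos i).le (h.eval_curvaturePoly i)).1 (h.slopePoly_sign i _)
  rw [curvaturePoly, eval_sub, h.eval_curvaturePoly i]
  simp only [eval_mul, eval_C, eval_X]
  linear_combination mul_pos (mul_pos (hw (Fin.last N)) (h.pos i)) hvalue

theorem IsSpectralSequence.exists_zeros_succ {w p : Fin (N + 1) → ℝ} (hw : ∀ i, 0 < w i)
    (hp0 : ∀ i, 0 < p i) (hp : StrictMono p) {y : Fin N → ℝ}
    (h : IsSpectralSequence (Fin.init w) (Fin.init p) y) :
    ∃ u : Fin (N + 1) → ℝ, (∀ j, 0 < u j) ∧ (∀ i : Fin N, u i.castSucc < y i) ∧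
      (∀ i : Fin N, y i < u i.succ) ∧ ∀ j, (curvaturePoly w p).eval (u j) = 0 := by
  obtain ⟨M, hM_sign, hM_pos, hyM⟩ := ((eventually_neg_one_pow_mul_eval_curvaturePoly_pos hw hp0
    hp).and ((eventually_gt_atTop 0).and
      (eventually_all.2 fun i => eventually_gt_atTop (y i)))).exists
  let t : Fin (N + 2) → ℝ := Fin.cons 0 (Fin.snoc y M : Fin (N + 1) → ℝ)
  have ht : StrictMono t := by
    refine Fin.strictMono_cons.2 ⟨fun j => ?_, strictMono_snoc h.strictMono hyM⟩
    cases j using Fin.lastCases with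
    | last => simpa using hM_pos
    | cast i => simpa using h.pos i
  have ht_sign : ∀ j : Fin (N + 2), 0 < (-1) ^ (j : ℕ) * (curvaturePoly w p).eval (t j) := by
    intro j
    cases j using Fin.cases with
    | zero => simp [t, eval_zero_curvaturePoly]
    | succ j =>
      cases j using Fin.lastCases with
      | last => simpa [t] using hM_sign
      | cast i =>
        simpa [t] using h.neg_one_pow_mul_eval_curvaturePoly_succ_pos hw (hp0 _) hp.monotone i
  obtain ⟨u, hu⟩ := exists_zeros_of_alternating_signs (curvaturePoly w p).continuous ht ht_sign
  refine ⟨u, fun j => ?_, fun i => ?_, fun i => ?_, fun j => (hu j).2⟩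
  · exact (ht.monotone (Fin.zero_le j.castSucc)).trans_lt (hu j).1.1
  · simpa [t] using (hu i.castSucc).1.2
  · simpa [t, ← Fin.succ_castSucc] using (hu i.succ).1.1

theorem exists_isSpectralSequence {w p : Fin N → ℝ} (hw : ∀ i, 0 < w i) (hp0 : ∀ i, 0 < p i)
    (hp : StrictMono p) : ∃ y, IsSpectralSequence w p y := by
  induction N with
  | zero => exact ⟨Fin.elim0, Subsingleton.strictMono _, fun i => i.elim0, by simp [curvaturePoly],
      fun i => i.elim0⟩
  | succ N ih =>
    obtain ⟨y, hy⟩ := ih (w := Fin.init w) (p := Fin.init p) (fun i => hw i.castSucc)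
      (fun i => hp0 i.castSucc) (hp.comp Fin.strictMono_castSucc)
    obtain ⟨u, hu_pos, hu_lt, hu_gt, hu_root⟩ := hy.exists_zeros_succ hw hp0 hp
    have hu : StrictMono u := Fin.strictMono_iff_lt_succ.2 fun i => (hu_lt i).trans (hu_gt i)
    refine ⟨u, hu, hu_pos, eq_prod_one_sub_of_eval_eq_zero (natDegree_curvaturePoly_le w p)
      (eval_zero_curvaturePoly w p) hu.injective (fun j => (hu_pos j).ne') hu_root, fun j x => ?_⟩
    rw [eval_slopePoly_eq_of_eval_curvaturePoly_eq_zero (hu_root j) x (p (Fin.last N)),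
      mul_eval_slopePoly_pos_iff (fun i => (hw i).le) (hp0 _)
        (fun i => hp.monotone (Fin.le_last i)) (hu_pos j).le (hu_root j), valuePoly_last]
    have hcurv_sign : 0 < (-1) ^ (j : ℕ) *
        (curvaturePoly (Fin.init w) (Fin.init p)).eval (u j) := by
      rw [hy.curvaturePoly_eq]
      refine neg_one_pow_mul_eval_prod_one_sub_pos hy.pos (fun i hi => ?_) fun i hi => ?_
      · exact (hu_gt i).trans_le (hu.monotone (Fin.castSucc_lt_iff_succ_le.1 hi))
      · exact (hu.monotone hi).trans_lt (hu_lt i)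
    have hdrop : (curvaturePoly (Fin.init w) (Fin.init p)).eval (u j) = w (Fin.last N) * u j *
        (valuePoly (Fin.init w) (Fin.init p) (p (Fin.last N))).eval (u j) := by
      have := hu_root j
      simp only [curvaturePoly, eval_sub, eval_mul, eval_C, eval_X] at this
      linarith
    rw [hdrop, mul_left_comm] at hcurv_sign
    exact (mul_pos_iff_of_pos_left (mul_pos (hw _) (hu_pos j))).1 hcurv_sign

end Interlacing

section PartialFractions

theorem eval_div_eval_eq_sum_residues {K ι : Type*} [Field K] {s : Finset ι}
    {v : ι → K} (hv : Set.InjOn v s) {P Q : K[X]} (hP : P.degree < s.card) {e : K}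
    (hQ : Q = C e * Lagrange.nodal s v) {z : K} (hz : ∀ i ∈ s, z ≠ v i) :
    P.eval z / Q.eval z = ∑ i ∈ s, P.eval (v i) / Q.derivative.eval (v i) * (1 / (z - v i)) := by
  classical
  have hnodal := Lagrange.eval_nodal_not_at_node hz
  rw [hQ, Lagrange.eq_interpolate hv hP, Lagrange.eval_interpolate_not_at_node _ hz,
    ← Lagrange.eq_interpolate hv hP, eval_mul, eval_C, mul_comm e, mul_div_mul_left _ _ hnodal,
    Finset.sum_div]
  refine Finset.sum_congr rfl fun i hi => ?_
  rw [derivative_C_mul, eval_mul, eval_C, Lagrange.nodalWeight_eq_eval_derivative_nodal hi]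
  ring

theorem aeval_div_aeval_eq_sum_residues {K L ι : Type*} [Field K] [Field L] [Algebra K L]
    {s : Finset ι} {v : ι → K} (hv : Set.InjOn v s) {P Q : K[X]}
    (hP : P.degree < s.card) {e : K} (hQ : Q = C e * Lagrange.nodal s v) {z : L}
    (hz : ∀ i ∈ s, z ≠ algebraMap K L (v i)) :
    aeval z P / aeval z Q = ∑ i ∈ s,
      (P.eval (v i) / Q.derivative.eval (v i)) • (1 / (z - algebraMap K L (v i))) := by
  have hQ_map : Q.map (algebraMap K L) = C (algebraMap K L e) *
      Lagrange.nodal s (fun i => algebraMap K L (v i)) := by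
    simp [hQ, Lagrange.nodal, Polynomial.map_prod]
  have hmap := eval_div_eval_eq_sum_residues ((algebraMap K L).injective.comp_injOn hv)
    (P := P.map (algebraMap K L)) (by rwa [degree_map]) hQ_map hz
  simpa [Algebra.smul_def, derivative_map, eval_map_algebraMap, aeval_algebraMap_apply] using hmap

theorem prod_one_sub_eq_C_mul_nodal {K ι : Type*} [Field K] {s : Finset ι} {v : ι → K}
    (hv : ∀ i ∈ s, v i ≠ 0) :
    ∏ i ∈ s, (1 - C (v i)⁻¹ * X) = C (∏ i ∈ s, -(v i)⁻¹) * Lagrange.nodal s v := by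
  rw [Lagrange.nodal, map_prod, ← Finset.prod_mul_distrib]
  refine Finset.prod_congr rfl fun i hi => ?_
  rw [mul_sub, ← C_mul, neg_mul, inv_mul_cancel₀ (hv i hi)]
  simp only [map_neg, neg_mul, map_one, sub_neg_eq_add]
  ring

end PartialFractions

section WeylFunctions

theorem IsSpectralSequence.aeval_curvaturePoly_eq_zero_iff {N : ℕ} {w p y : Fin N → ℝ}
    (h : IsSpectralSequence w p y) {L : Type*} [Field L] [Algebra ℝ L] {z : L} :
    aeval z (curvaturePoly w p) = 0 ↔ ∃ i, algebraMap ℝ L (y i) = z := by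
  rw [h.curvaturePoly_eq, map_prod, Finset.prod_eq_zero_iff]
  refine exists_congr fun i => ?_
  have hyi : algebraMap ℝ L (y i) ≠ 0 := by simpa using (h.pos i).ne'
  simp only [map_sub, map_one, map_mul, aeval_C, aeval_X]
  rw [map_inv₀, sub_eq_zero, eq_comm, inv_mul_eq_one₀ hyi]
  exact and_iff_right (Finset.mem_univ i)

theorem IsSpectralSequence.aeval_div_aeval_curvaturePoly {N : ℕ} {w p y : Fin N → ℝ}
    (h : IsSpectralSequence w p y) {P : ℝ[X]} (hP : P.degree < N) {L : Type*} [Field L]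
    [Algebra ℝ L] {z : L} (hz : aeval z (curvaturePoly w p) ≠ 0) :
    aeval z P / aeval z (curvaturePoly w p) = ∑ i, (P.eval (y i) /
      (curvaturePoly w p).derivative.eval (y i)) • (1 / (z - algebraMap ℝ L (y i))) := by
  refine aeval_div_aeval_eq_sum_residues h.strictMono.injective.injOn (by simpa using hP)
    (h.curvaturePoly_eq.trans (prod_one_sub_eq_C_mul_nodal fun i _ => (h.pos i).ne'))
    fun i _ hzi => hz (h.aeval_curvaturePoly_eq_zero_iff.2 ⟨i, hzi.symm⟩)

theorem IsSpectralSequence.neg_one_pow_mul_eval_derivative_curvaturePoly_neg {N : ℕ}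
    {w p y : Fin N → ℝ} (h : IsSpectralSequence w p y) (i : Fin N) :
    (-1) ^ (i : ℕ) * (curvaturePoly w p).derivative.eval (y i) < 0 := by
  rw [h.curvaturePoly_eq]
  exact neg_one_pow_mul_eval_derivative_prod_one_sub_neg h.pos h.strictMono i

variable {N : ℕ} {w p y : Fin (N + 1) → ℝ}

/-- The residue `-φ_ξ(1; yᵢ) / φ_ξξz(1; yᵢ)` of the Weyl function `W` at the eigenvalue `yᵢ` of a
string whose last mass sits at its end point. -/
noncomputable def weylWeight (w p y : Fin (N + 1) → ℝ) (i : Fin (N + 1)) : ℝ :=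
  -(slopePoly w p (p (Fin.last N))).eval (y i) / (curvaturePoly w p).derivative.eval (y i)

theorem IsSpectralSequence.weylWeight_pos (h : IsSpectralSequence w p y) (i : Fin (N + 1)) :
    0 < weylWeight w p y i := by
  rw [weylWeight, ← mul_div_mul_left _ _ (pow_ne_zero (i : ℕ) (neg_ne_zero.2 one_ne_zero)), mul_neg]
  exact div_pos_of_neg_of_neg (neg_lt_zero.2 (h.slopePoly_sign i _))
    (h.neg_one_pow_mul_eval_derivative_curvaturePoly_neg i)

theorem IsSpectralSequence.neg_aeval_slopePoly_div (h : IsSpectralSequence w p y) {L : Type*}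
    [Field L] [Algebra ℝ L] {z : L} (hz : aeval z (curvaturePoly w p) ≠ 0) :
    -aeval z (slopePoly w p (p (Fin.last N))) / aeval z (curvaturePoly w p) =
      ∑ i, weylWeight w p y i • (1 / (z - algebraMap ℝ L (y i))) := by
  have hdeg : (-slopePoly w p (p (Fin.last N))).degree < (N + 1 : ℕ) := by
    rw [degree_neg, slopePoly_last]
    exact (degree_le_of_natDegree_le (natDegree_slopePoly_le _ _ _)).trans_lt
      (mod_cast N.lt_succ_self)
  rw [← map_neg, h.aeval_div_aeval_curvaturePoly hdeg hz]
  simp only [weylWeight, eval_neg]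

theorem IsSpectralSequence.neg_eval_valuePoly_div (h : IsSpectralSequence w p y) (hw : ∀ i, 0 ≤ w i)
    (j : Fin (N + 1)) :
    -(valuePoly w p (p (Fin.last N))).eval (y j) / (curvaturePoly w p).derivative.eval (y j) =
      weylWeight w p y j * ∑ i, weylWeight w p y i / (y i + y j) := by
  have hcurv_neg : (curvaturePoly w p).eval (-y j) ≠ 0 :=
    (zero_lt_one.trans_le (one_le_eval_neg_curvaturePoly hw (h.pos j).le)).ne'
  have hslope_neg : ∑ i, weylWeight w p y i / (y i + y j) =
      (slopePoly w p (p (Fin.last N))).eval (-y j) / (curvaturePoly w p).eval (-y j) := by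
    have := h.neg_aeval_slopePoly_div (z := -y j) (by simpa using hcurv_neg)
    simp only [coe_aeval_eq_eval, neg_div, neg_eq_iff_eq_neg] at this
    rw [this, ← Finset.sum_neg_distrib]
    refine Finset.sum_congr rfl fun i _ => ?_
    rw [Algebra.algebraMap_self_apply, ← neg_add', add_comm, smul_eq_mul, one_div, inv_neg, mul_neg,
      neg_neg, div_eq_mul_inv]
  have hvalue : (valuePoly w p (p (Fin.last N))).eval (y j) =
      (slopePoly w p (p (Fin.last N))).eval (y j) *
        ((slopePoly w p (p (Fin.last N))).eval (-y j) / (curvaturePoly w p).eval (-y j)) := by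
    have := bilinear_concomitant_eq_zero w p (p (Fin.last N)) (y j)
    rw [h.eval_curvaturePoly] at this
    rw [← mul_div_assoc, eq_div_iff hcurv_neg]
    linear_combination this
  rw [hslope_neg, hvalue, weylWeight]
  ring

theorem IsSpectralSequence.neg_aeval_valuePoly_div (h : IsSpectralSequence w p y)
    (hw : ∀ i, 0 ≤ w i) {L : Type*} [Field L] [Algebra ℝ L] {z : L}
    (hz : aeval z (curvaturePoly w p) ≠ 0) :
    -aeval z (valuePoly w p (p (Fin.last N))) / aeval z (curvaturePoly w p) =
      ∑ i, weylWeight w p y i • ∑ j, weylWeight w p y j •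
        (1 / ((z - algebraMap ℝ L (y j)) * (algebraMap ℝ L (y i) + algebraMap ℝ L (y j)))) := by
  have hdeg : (-valuePoly w p (p (Fin.last N))).degree < (N + 1 : ℕ) := by
    rw [degree_neg, valuePoly_last]
    exact (degree_le_of_natDegree_le (natDegree_valuePoly_le _ _ _)).trans_lt
      (mod_cast N.lt_succ_self)
  rw [← map_neg, h.aeval_div_aeval_curvaturePoly hdeg hz]
  simp only [eval_neg, h.neg_eval_valuePoly_div hw, Finset.smul_sum, Finset.mul_sum,
    Finset.sum_smul]
  rw [Finset.sum_comm]
  refine Finset.sum_congr rfl fun i _ => Finset.sum_congr rfl fun j _ => ?_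
  simp only [Algebra.smul_def, map_mul, map_div₀, map_add, one_div, mul_inv]
  ring

end WeylFunctions

section EndValues

variable {N : ℕ} {w p y : Fin (N + 1) → ℝ}

theorem IsIVPSolution.endValues_eq (hw : ∀ i, 0 ≤ w i) (hp0 : ∀ i, 0 < p i) (hp : Monotone p)
    (hp1 : p (Fin.last N) = 1) {z : ℂ} {f : ℝ → ℂ} (hf : IsIVPSolution (pointMasses w p) z f) :
    endValue 0 f = aeval z (valuePoly w p (p (Fin.last N))) ∧
      endValue 1 f = aeval z (slopePoly w p (p (Fin.last N))) ∧
      endValue 2 f = aeval z (curvaturePoly w p) := by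
  have hend (k : Fin 3) := ((isIVPSolution_iff hw hp0).1 hf).endValue_eq hp
    (fun i => hp1 ▸ hp (Fin.le_last i)) k
  simp only [one_mul, ← hp1] at hend
  exact ⟨hend 0, hend 1, hend 2⟩

theorem IsIVPSolution.tendsto_endValue (hw : ∀ i, 0 ≤ w i) (hp0 : ∀ i, 0 < p i) (hp : Monotone p)
    (hp1 : ∀ i, p i ≤ 1) {z : ℂ} {f : ℝ → ℂ} (hf : IsIVPSolution (pointMasses w p) z f)
    {k : ℕ} (hk : k ≤ 2) : Tendsto (iteratedDeriv k f) (𝓝[>] 1) (𝓝 (endValue k f)) := by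
  have hsol := (isIVPSolution_iff hw hp0).1 hf
  have hlim := hsol.tendsto_iteratedDeriv hp hp1 ⟨k, Nat.lt_succ_of_le hk⟩
  rwa [← hsol.endValue_eq hp hp1] at hlim

theorem IsSpectralSequence.range_eq_spectrumType2 (h : IsSpectralSequence w p y)
    (hw : ∀ i, 0 ≤ w i) (hp : Monotone p) (hp0 : ∀ i, 0 < p i) (hp1 : ∀ i, p i ≤ 1) :
    Set.range (fun i => (y i : ℂ)) = spectrumType2 (pointMasses w p) :=
  Set.ext fun _ =>
    (mem_spectrumType2_iff hw hp hp0 hp1 |>.trans h.aeval_curvaturePoly_eq_zero_iff).symm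

theorem hasDerivAt_aeval_ofReal (P : ℝ[X]) (x : ℝ) :
    HasDerivAt (fun z : ℂ => aeval z P) ((P.derivative.eval x : ℝ) : ℂ) x := by
  have := P.hasDerivAt_aeval (x : ℂ)
  rwa [← Complex.coe_algebraMap, aeval_algebraMap_apply_eq_algebraMap_eval] at this

theorem coe_weylWeight (w p y : Fin (N + 1) → ℝ) (i : Fin (N + 1)) :
    (weylWeight w p y i : ℂ) = -aeval (y i : ℂ) (slopePoly w p (p (Fin.last N))) /
      ((curvaturePoly w p).derivative.eval (y i) : ℝ) := by
  rw [weylWeight, Complex.ofReal_div, Complex.ofReal_neg, ← Complex.coe_algebraMap,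
    aeval_algebraMap_apply_eq_algebraMap_eval]

theorem IsSpectralSequence.neg_aeval_slopePoly_div_eq_integral (h : IsSpectralSequence w p y)
    {z : ℂ} (hz : aeval z (curvaturePoly w p) ≠ 0) :
    -aeval z (slopePoly w p (p (Fin.last N))) / aeval z (curvaturePoly w p) =
      ∫ t : ℝ, 1 / (z - (t : ℂ)) ∂pointMasses (weylWeight w p y) y := by
  rw [h.neg_aeval_slopePoly_div hz, integral_pointMasses fun i => (h.weylWeight_pos i).le]
  rfl

theorem IsSpectralSequence.neg_aeval_valuePoly_div_eq_integral (h : IsSpectralSequence w p y)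
    (hw : ∀ i, 0 ≤ w i) {z : ℂ} (hz : aeval z (curvaturePoly w p) ≠ 0) :
    -aeval z (valuePoly w p (p (Fin.last N))) / aeval z (curvaturePoly w p) =
      ∫ t : ℝ × ℝ, 1 / ((z - (t.2 : ℂ)) * ((t.1 : ℂ) + (t.2 : ℂ)))
        ∂(pointMasses (weylWeight w p y) y).prod (pointMasses (weylWeight w p y) y) := by
  rw [h.neg_aeval_valuePoly_div hw hz, integral_pointMasses_prod
    (fun i => (h.weylWeight_pos i).le) fun i => (h.weylWeight_pos i).le]
  rfl

end EndValues

end CubicString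

theorem mainTheorem4 (n : ℕ) (m ξ : Fin (n + 1) → ℝ) (hm : ∀ i, 0 < m i) (hξ0 : 0 < ξ 0)
    (hξ : StrictMono ξ) (hξ1 : ξ (Fin.last n) = 1) :
    (∀ z : ℂ, ∃! f : ℝ → ℂ, CubicString.IsIVPSolution (CubicString.pointMasses m ξ) z f) ∧
    ∀ φ : ℂ → ℝ → ℂ,
      (∀ z, CubicString.IsIVPSolution (CubicString.pointMasses m ξ) z (φ z)) →
      (∀ z, ∀ k ≤ 2, Tendsto (iteratedDeriv k (φ z)) (𝓝[>] 1)
        (𝓝 (CubicString.endValue k (φ z)))) ∧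
      ∃ y b : Fin (n + 1) → ℝ,
        StrictMono y ∧ (∀ i, 0 < y i) ∧
        Set.range (fun i => (y i : ℂ)) =
          CubicString.spectrumType2 (CubicString.pointMasses m ξ) ∧
        (∀ i, 0 < b i) ∧
        (∀ i, DifferentiableAt ℂ (fun z => CubicString.endValue 2 (φ z)) (y i)) ∧
        (∀ i, deriv (fun z => CubicString.endValue 2 (φ z)) (y i) ≠ 0) ∧
        (∀ i, (b i : ℂ) = -CubicString.endValue 1 (φ (y i)) /
          deriv (fun z => CubicString.endValue 2 (φ z)) (y i)) ∧
        ∀ z ∉ CubicString.spectrumType2 (CubicString.pointMasses m ξ),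
          CubicString.endValue 2 (φ z) ≠ 0 ∧
          (Integrable (fun t : ℝ => 1 / (z - (t : ℂ))) (CubicString.pointMasses b y) ∧
            CubicString.weylW φ z =
              ∫ t : ℝ, 1 / (z - (t : ℂ)) ∂(CubicString.pointMasses b y)) ∧
          (Integrable (fun p : ℝ × ℝ => 1 / ((z - (p.2 : ℂ)) * ((p.1 : ℂ) + (p.2 : ℂ))))
              ((CubicString.pointMasses b y).prod (CubicString.pointMasses b y)) ∧
            CubicString.weylZ φ z =
              ∫ p : ℝ × ℝ, 1 / ((z - (p.2 : ℂ)) * ((p.1 : ℂ) + (p.2 : ℂ)))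
                ∂((CubicString.pointMasses b y).prod (CubicString.pointMasses b y))) := by
  have hm0 : ∀ i, 0 ≤ m i := fun i => (hm i).le
  have hξpos : ∀ i, 0 < ξ i := fun i => hξ0.trans_le (hξ.monotone (Fin.zero_le i))
  have hξle : ∀ i, ξ i ≤ 1 := fun i => hξ1 ▸ hξ.monotone (Fin.le_last i)
  obtain ⟨y, hy⟩ := CubicString.exists_isSpectralSequence hm hξpos hξ
  refine ⟨fun z => by simpa only [CubicString.isIVPSolution_iff hm0 hξpos] using
    CubicString.existsUnique_solvesVolterra hξ.monotone z 1, fun φ hφ => ?_⟩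
  choose hvalue hslope hcurv using fun z =>
    (hφ z).endValues_eq hm0 hξpos hξ.monotone hξ1
  have hderiv (i : Fin (n + 1)) : HasDerivAt (fun z => CubicString.endValue 2 (φ z))
      (((CubicString.curvaturePoly m ξ).derivative.eval (y i) : ℝ) : ℂ) (y i) :=
    (CubicString.hasDerivAt_aeval_ofReal _ _).congr_of_eventuallyEq (.of_eq (funext hcurv))
  refine ⟨fun z k hk => (hφ z).tendsto_endValue hm0 hξpos hξ.monotone hξle hk, y,
    CubicString.weylWeight m ξ y, hy.strictMono, hy.pos,
    hy.range_eq_spectrumType2 hm0 hξ.monotone hξpos hξle, hy.weylWeight_pos,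
    fun i => (hderiv i).differentiableAt, fun i => ?_, fun i => ?_, fun z hz => ?_⟩
  · rw [(hderiv i).deriv]
    exact mod_cast right_ne_zero_of_mul (hy.neg_one_pow_mul_eval_derivative_curvaturePoly_neg i).ne
  · rw [(hderiv i).deriv, hslope]
    exact CubicString.coe_weylWeight m ξ y i
  · rw [CubicString.mem_spectrumType2_iff hm0 hξ.monotone hξpos hξle] at hz
    rw [CubicString.weylW, CubicString.weylZ, hvalue, hslope, hcurv]
    exact ⟨hz,
      ⟨CubicString.integrable_pointMasses _, hy.neg_aeval_slopePoly_div_eq_integral hz⟩,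
      CubicString.integrable_pointMasses_prod _, hy.neg_aeval_valuePoly_div_eq_integral hm0 hz⟩
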